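/- Let $k\ge 1$. A $k$-partitioned measure $2$-network is $P=((X_i,\mu_i)_{i=1}^k,\omega)$, where the $X_i$ are pairwise disjoint Polish spaces, each $\mu_i$ is a Borel probability measure on $X_i$, and, with $X=\bigsqcup_i X_i$ and $\mu=\sum_i\mu_i$, the kernel $\omega:X\times X\to[0,\infty)$ belongs to $L^2(\mu\otimes\mu)$. Let $\mathcal P_k^2$ be the collection of these networks. For $P,P'\in\mathcal P_k^2$ put $$d_{\mathcal P_k^2}(P,P')=\inf_{(\pi_i)}\ \frac12\Big(\sum_{i,j=1}^k\|\omega-\omega'\|_{L^2(\pi_i\otimes\pi_j)}^2\Big)^{1/2},$$ where the infimum is over all tuples $(\pi_i)_{i=1}^k$ in which $\pi_i$ is a coupling of $\mu_i$ and $\mu_i'$, and $(\omega-\omega')(x,x',y,y')=\omega(x,y)-\omega'(x',y')$. A weak isomorphism from $P$ to $P'$ is a tuple of Borel measurable maps $\phi_i:X_i\to X_i'$ such that $(\phi_i)_\#\mu_i=\mu_i'$ for all $i$ and, for all $i,j$, $\omega(x,y)=\omega'(\phi_i(x),\phi_j(y))$ for $\mu_i\otimes\mu_j$-almost every $(x,y)\in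 X_i\times X_j$. The networks $P$ and $P'$ are weakly isomorphic if there is a $k$-partitioned measure $2$-network $\overline P$ with weak isomorphisms from $\overline P$ to $P$ and from $\overline P$ to $P'$; this is an equivalence relation, and $[\mathcal P_k^2]$ denotes the collection of its classes. Then $d_{\mathcal P_k^2}$ induces a well-defined metric on $[\mathcal P_k^2]$, and $([\mathcal P_k^2],d_{\mathcal P_k^2})$ is an Alexandrov space of non-negative curvature. That is: 1. it is complete; 2. it is a geodesic space: any two points $x,y$ are joined by a geodesic, i.e. a map $\gamma:[0,1]\to[\mathcal P_k^2]$ with $\gamma(0)=x$, $\gamma(1)=y$ and $d(\gamma(s),\gamma(t))=(t-s)\,d(x,y)$ for all $0\le s\le t\le 1$; 3. for every geodesic $\gamma$, every point $x$ and every $t\in[0,1]$, $$d(\gamma(t),x)^2\ \ge\ (1-t)\,d(\gamma(0),x)^2+t\,d(\gamma(1),x)^2-t(1-t)\,d(\gamma(0),\gamma(1))^2 .$$ -/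

import Mathlib

open MeasureTheory ProbabilityTheory
open scoped ENNReal

universe u v

/-! ### Geodesics and curvature in metric spaces -/

/-- `γ : [0,1] → X` is a geodesic from `x` to `y`. -/
def IsGeodesic {X : Type v} [MetricSpace X] (γ : Set.Icc (0 : ℝ) 1 → X) (x y : X) : Prop :=
  γ 0 = x ∧ γ 1 = y ∧
    ∀ s t : Set.Icc (0 : ℝ) 1, s ≤ t → dist (γ s) (γ t) = ((t : ℝ) - (s : ℝ)) * dist x y

/-- Any two points are joined by a geodesic. -/
def IsGeodesicSpace (X : Type v) [MetricSpace X] : Prop :=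
  ∀ x y : X, ∃ γ : Set.Icc (0 : ℝ) 1 → X, IsGeodesic γ x y

/-- The comparison inequality expressing that the curvature is bounded below by zero. -/
def HasCurvatureBoundedBelowByZero (X : Type v) [MetricSpace X] : Prop :=
  ∀ (γ : Set.Icc (0 : ℝ) 1 → X), IsGeodesic γ (γ 0) (γ 1) →
    ∀ (x : X) (t : Set.Icc (0 : ℝ) 1),
      (1 - (t : ℝ)) * dist (γ 0) x ^ 2 + (t : ℝ) * dist (γ 1) x ^ 2
        - (t : ℝ) * (1 - (t : ℝ)) * dist (γ 0) (γ 1) ^ 2 ≤ dist (γ t) x ^ 2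

/-- An Alexandrov space of non-negative curvature: a complete geodesic metric space with curvature
bounded below by zero. -/
structure IsAlexandrovSpaceNonneg (X : Type v) [MetricSpace X] : Prop where
  complete : CompleteSpace X
  geodesic : IsGeodesicSpace X
  curvature : HasCurvatureBoundedBelowByZero X

/-! ### Partitioned measure networks -/

/-- The sum `∑ i, μ i` of measures on the blocks `X i`, as a measure on the disjoint union
`⊔ i, X i`. -/
noncomputable def sigmaMeasure {k : ℕ} {X : Fin k → Type u} [∀ i, MeasurableSpace (X i)]
    (μ : ∀ i, Measure (X i)) : Measure (Σ i, X i) :=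
  Measure.sum fun i => (μ i).map (Sigma.mk i)

/-- A `k`-partitioned measure `2`-network: Polish probability spaces `(X i, μ i)` for `i < k`,
together with a kernel `ω` on the disjoint union `⊔ i, X i` which takes values in `[0, ∞)` and is
square integrable for the product of `∑ i, μ i` with itself. -/
structure PartitionedMeasureNetwork (k : ℕ) : Type (u + 1) where
  X : Fin k → Type u
  [top : ∀ i, TopologicalSpace (X i)]
  [polish : ∀ i, PolishSpace (X i)]
  [meas : ∀ i, MeasurableSpace (X i)]
  [borel : ∀ i, BorelSpace (X i)]
  μ : ∀ i, Measure (X i)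
  [prob : ∀ i, IsProbabilityMeasure (μ i)]
  ω : (Σ i, X i) → (Σ i, X i) → ℝ
  ω_nonneg : ∀ x y, 0 ≤ ω x y
  ω_memLp : MemLp (fun z : (Σ i, X i) × (Σ i, X i) => ω z.1 z.2) 2
    ((sigmaMeasure μ).prod (sigmaMeasure μ))

namespace PartitionedMeasureNetwork

attribute [instance] top polish meas borel prob

variable {k : ℕ}

/-! ### Couplings and the partitioned network distance -/

/-- The `k`-partitioned couplings of the tuples `(P.μ i)` and `(Q.μ i)`: tuples `(π i)` such that
`π i` is a measure on `P.X i × Q.X i` with marginals `P.μ i` and `Q.μ i`. -/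
def partitionedCouplings (P Q : PartitionedMeasureNetwork.{u} k) :
    Set (∀ i, Measure (P.X i × Q.X i)) :=
  {π | ∀ i, (π i).map Prod.fst = P.μ i ∧ (π i).map Prod.snd = Q.μ i}

/-- `‖ω - ω'‖` in `L²(π i ⊗ π j)`, where
`(ω - ω') ((x, x'), (y, y')) = ω (x, y) - ω' (x', y')`. -/
noncomputable def blockDistortion (P Q : PartitionedMeasureNetwork.{u} k)
    (π : ∀ i, Measure (P.X i × Q.X i)) (i j : Fin k) : ℝ≥0∞ :=
  eLpNorm (fun z : (P.X i × Q.X i) × (P.X j × Q.X j) =>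
      P.ω ⟨i, z.1.1⟩ ⟨j, z.2.1⟩ - Q.ω ⟨i, z.1.2⟩ ⟨j, z.2.2⟩) 2 ((π i).prod (π j))

/-- The partitioned network `2`-distance. -/
noncomputable def networkDist (P Q : PartitionedMeasureNetwork.{u} k) : ℝ≥0∞ :=
  ⨅ π ∈ partitionedCouplings P Q,
    (1 / 2) * (∑ i, ∑ j, blockDistortion P Q π i j ^ 2) ^ (1 / 2 : ℝ)

/-! ### Weak isomorphism -/

/-- `φ` is a weak isomorphism from `P` to `Q`. -/
def IsWeakIsomorphism (P Q : PartitionedMeasureNetwork.{u} k) (φ : ∀ i, P.X i → Q.X i) : Prop :=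
  (∀ i, MeasurePreserving (φ i) (P.μ i) (Q.μ i)) ∧
    ∀ i j, ∀ᵐ z ∂((P.μ i).prod (P.μ j)),
      P.ω ⟨i, z.1⟩ ⟨j, z.2⟩ = Q.ω ⟨i, φ i z.1⟩ ⟨j, φ j z.2⟩

/-- `P` and `Q` are weakly isomorphic: some third network has weak isomorphisms to both. -/
def WeaklyIsomorphic (P Q : PartitionedMeasureNetwork.{u} k) : Prop :=
  ∃ (R : PartitionedMeasureNetwork.{u} k) (φ : ∀ i, R.X i → P.X i) (ψ : ∀ i, R.X i → Q.X i),
    IsWeakIsomorphism R P φ ∧ IsWeakIsomorphism R Q ψ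

/-! Weak isomorphism is an equivalence relation. -/

instance sFinite_sigmaMeasure {X : Fin k → Type u} [∀ i, MeasurableSpace (X i)]
    (μ : ∀ i, Measure (X i)) [∀ i, SFinite (μ i)] : SFinite (sigmaMeasure μ) := by
  unfold sigmaMeasure; infer_instance

theorem measurable_sigmaMk {X : Fin k → Type u} [∀ i, MeasurableSpace (X i)] (i : Fin k) :
    Measurable (Sigma.mk i : X i → Σ i, X i) := by
  intro s hs
  exact (MeasurableSpace.measurableSet_iInf.1 hs) i

theorem measurePreserving_sigmaMap {X Y : Fin k → Type u} [∀ i, MeasurableSpace (X i)]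
    [∀ i, MeasurableSpace (Y i)] (μ : ∀ i, Measure (X i)) (ν : ∀ i, Measure (Y i))
    (φ : ∀ i, X i → Y i) (hφ : ∀ i, MeasurePreserving (φ i) (μ i) (ν i)) :
    MeasurePreserving (Sigma.map id φ) (sigmaMeasure μ) (sigmaMeasure ν) := by
  have hm : Measurable (Sigma.map id φ : (Σ i, X i) → Σ i, Y i) := by
    intro s hs
    refine MeasurableSpace.measurableSet_iInf.2 fun i => ?_
    exact (hφ i).measurable (measurable_sigmaMk i hs)
  refine ⟨hm, ?_⟩
  unfold sigmaMeasure
  rw [Measure.map_sum hm.aemeasurable]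
  congr 1
  funext i
  rw [Measure.map_map hm (measurable_sigmaMk i), ← (hφ i).map_eq,
    Measure.map_map (measurable_sigmaMk i) (hφ i).measurable]
  rfl

/-- Gluing of two measure preserving maps with the same target. -/
theorem exists_gluing {α β γ : Type u} [MeasurableSpace α] [MeasurableSpace β]
    [MeasurableSpace γ] [StandardBorelSpace α] [StandardBorelSpace β] [StandardBorelSpace γ]
    (μ : Measure α) (ν : Measure β) (ρ : Measure γ) [IsProbabilityMeasure μ]
    [IsProbabilityMeasure ν] [IsProbabilityMeasure ρ] (f : α → γ) (g : β → γ)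
    (hf : MeasurePreserving f μ ρ) (hg : MeasurePreserving g ν ρ) :
    ∃ τ : Measure (α × β), IsProbabilityMeasure τ ∧ MeasurePreserving Prod.fst τ μ ∧
      MeasurePreserving Prod.snd τ ν ∧ ∀ᵐ z ∂τ, f z.1 = g z.2 := by
  have : Nonempty α := μ.nonempty_of_neZero
  have : Nonempty β := ν.nonempty_of_neZero
  have hfm : Measurable fun a => (f a, a) := hf.measurable.prodMk measurable_id
  have hgm : Measurable fun b => (g b, b) := hg.measurable.prodMk measurable_id
  have : IsProbabilityMeasure (μ.map fun a => (f a, a)) :=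
    Measure.isProbabilityMeasure_map hfm.aemeasurable
  have : IsProbabilityMeasure (ν.map fun b => (g b, b)) :=
    Measure.isProbabilityMeasure_map hgm.aemeasurable
  set κ := (μ.map fun a => (f a, a)).condKernel with hκ
  set η := (ν.map fun b => (g b, b)).condKernel with hη
  have h1 : ρ ⊗ₘ κ = μ.map fun a => (f a, a) := by
    have h := (μ.map fun a => (f a, a)).disintegrate κ
    rwa [Measure.fst, Measure.map_map measurable_fst hfm,
      show (Prod.fst ∘ fun a => (f a, a)) = f from rfl, hf.map_eq] at h
  have h2 : ρ ⊗ₘ η = ν.map fun b => (g b, b) := by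
    have h := (ν.map fun b => (g b, b)).disintegrate η
    rwa [Measure.fst, Measure.map_map measurable_fst hgm,
      show (Prod.fst ∘ fun b => (g b, b)) = g from rfl, hg.map_eq] at h
  set σ := ρ ⊗ₘ (κ ×ₖ η) with hσ
  have hp1 : Measurable fun z : γ × (α × β) => (z.1, z.2.1) := by fun_prop
  have hp2 : Measurable fun z : γ × (α × β) => (z.1, z.2.2) := by fun_prop
  have e1 : σ.map (fun z : γ × (α × β) => (z.1, z.2.1)) = μ.map fun a => (f a, a) := by
    rw [← h1]
    ext s hs
    rw [Measure.map_apply hp1 hs, Measure.compProd_apply (hp1 hs), Measure.compProd_apply hs]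
    refine lintegral_congr fun c => ?_
    conv_rhs => rw [← Kernel.fst_prod κ η]
    rw [Kernel.fst_apply' _ _ (measurable_prodMk_left hs)]
    rfl
  have e2 : σ.map (fun z : γ × (α × β) => (z.1, z.2.2)) = ν.map fun b => (g b, b) := by
    rw [← h2]
    ext s hs
    rw [Measure.map_apply hp2 hs, Measure.compProd_apply (hp2 hs), Measure.compProd_apply hs]
    refine lintegral_congr fun c => ?_
    conv_rhs => rw [← Kernel.snd_prod κ η]
    rw [Kernel.snd_apply' _ _ (measurable_prodMk_left hs)]
    rfl
  have a1 : ∀ᵐ z ∂σ, f z.2.1 = z.1 := by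
    have : ∀ᵐ w ∂(σ.map fun z : γ × (α × β) => (z.1, z.2.1)), f w.2 = w.1 := by
      have hset : MeasurableSet {w : γ × α | f w.2 = w.1} :=
        measurableSet_eq_fun (hf.measurable.comp measurable_snd) measurable_fst
      rw [e1]
      refine (ae_map_iff hfm.aemeasurable hset).2 ?_
      exact Filter.Eventually.of_forall fun _ => rfl
    exact ae_of_ae_map hp1.aemeasurable this
  have a2 : ∀ᵐ z ∂σ, g z.2.2 = z.1 := by
    have : ∀ᵐ w ∂(σ.map fun z : γ × (α × β) => (z.1, z.2.2)), g w.2 = w.1 := by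
      have hset : MeasurableSet {w : γ × β | g w.2 = w.1} :=
        measurableSet_eq_fun (hg.measurable.comp measurable_snd) measurable_fst
      rw [e2]
      refine (ae_map_iff hgm.aemeasurable hset).2 ?_
      exact Filter.Eventually.of_forall fun _ => rfl
    exact ae_of_ae_map hp2.aemeasurable this
  refine ⟨σ.map Prod.snd, Measure.isProbabilityMeasure_map measurable_snd.aemeasurable,
    ⟨measurable_fst, ?_⟩, ⟨measurable_snd, ?_⟩, ?_⟩
  · have h := congrArg (Measure.map Prod.snd) e1
    rw [Measure.map_map measurable_snd hp1, Measure.map_map measurable_snd hfm] at h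
    rw [Measure.map_map measurable_fst measurable_snd]
    exact h.trans Measure.map_id
  · have h := congrArg (Measure.map Prod.snd) e2
    rw [Measure.map_map measurable_snd hp2, Measure.map_map measurable_snd hgm] at h
    rw [Measure.map_map measurable_snd measurable_snd]
    exact h.trans Measure.map_id
  · have hset : MeasurableSet {w : α × β | f w.1 = g w.2} :=
      measurableSet_eq_fun (hf.measurable.comp measurable_fst) (hg.measurable.comp measurable_snd)
    refine (ae_map_iff measurable_snd.aemeasurable hset).2 ?_
    filter_upwards [a1, a2] with z hz1 hz2
    exact hz1.trans hz2.symm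

theorem weaklyIsomorphic_trans {P Q R : PartitionedMeasureNetwork.{u} k}
    (hPQ : WeaklyIsomorphic P Q) (hQR : WeaklyIsomorphic Q R) : WeaklyIsomorphic P R := by
  obtain ⟨A, φ, φ', hφ, hφ'⟩ := hPQ
  obtain ⟨B, ψ, ψ', hψ, hψ'⟩ := hQR
  choose τ hτ hτ1 hτ2 hτe using fun i =>
    exists_gluing (A.μ i) (B.μ i) (Q.μ i) (φ' i) (ψ i) (hφ'.1 i) (hψ.1 i)
  have hs := measurePreserving_sigmaMap τ A.μ (fun i => Prod.fst) hτ1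
  refine ⟨{ X := fun i => A.X i × B.X i
            μ := τ
            ω := fun x y => A.ω (Sigma.map id (fun i => Prod.fst) x)
              (Sigma.map id (fun i => Prod.fst) y)
            ω_nonneg := fun x y => A.ω_nonneg _ _
            ω_memLp := A.ω_memLp.comp_measurePreserving (hs.prod hs) },
    fun i z => φ i z.1, fun i z => ψ' i z.2, ⟨fun i => (hφ.1 i).comp (hτ1 i), fun i j => ?_⟩,
    ⟨fun i => (hψ'.1 i).comp (hτ2 i), fun i j => ?_⟩⟩
  · exact ((hτ1 i).prod (hτ1 j)).quasiMeasurePreserving.ae (hφ.2 i j)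
  · have h1 := ((hτ1 i).prod (hτ1 j)).quasiMeasurePreserving.ae (hφ'.2 i j)
    have h2 := ((hτ2 i).prod (hτ2 j)).quasiMeasurePreserving.ae (hψ.2 i j)
    have h3 := ((hτ2 i).prod (hτ2 j)).quasiMeasurePreserving.ae (hψ'.2 i j)
    have h4 := (Measure.quasiMeasurePreserving_fst (μ := τ i) (ν := τ j)).ae (hτe i)
    have h5 := (Measure.quasiMeasurePreserving_snd (μ := τ i) (ν := τ j)).ae (hτe j)
    filter_upwards [h1, h2, h3, h4, h5] with z e1 e2 e3 e4 e5
    simp only [Prod.map_fst, Prod.map_snd] at e1 e2 e3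
    simp only [Sigma.map, id]
    rw [e1, e4, e5, ← e2, e3]

theorem equivalence_weaklyIsomorphic :
    Equivalence (WeaklyIsomorphic (k := k) :
      PartitionedMeasureNetwork.{u} k → PartitionedMeasureNetwork.{u} k → Prop) where
  refl P := ⟨P, fun _ => id, fun _ => id,
    ⟨fun _ => MeasurePreserving.id _, fun _ _ => Filter.Eventually.of_forall fun _ => rfl⟩,
    ⟨fun _ => MeasurePreserving.id _, fun _ _ => Filter.Eventually.of_forall fun _ => rfl⟩⟩
  symm := fun ⟨R, φ, ψ, hφ, hψ⟩ => ⟨R, ψ, φ, hψ, hφ⟩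
  trans := weaklyIsomorphic_trans

/-- Weak isomorphism as an equivalence relation on `k`-partitioned measure networks. -/
def weakIsomorphismSetoid (k : ℕ) : Setoid (PartitionedMeasureNetwork.{u} k) :=
  ⟨WeaklyIsomorphic, equivalence_weaklyIsomorphic⟩

end PartitionedMeasureNetwork

/-- The collection of weak isomorphism classes of `k`-partitioned measure `2`-networks. -/
def NetworkClass (k : ℕ) : Type (u + 1) :=
  Quotient (PartitionedMeasureNetwork.weakIsomorphismSetoid.{u} k)

/-- The weak isomorphism class of a network. -/
def PartitionedMeasureNetwork.toClass {k : ℕ} (P : PartitionedMeasureNetwork.{u} k) :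
    NetworkClass.{u} k :=
  Quotient.mk (PartitionedMeasureNetwork.weakIsomorphismSetoid.{u} k) P

/-! The kernel of a network is a nonnegative element of a real Hilbert space, `L2` of the squared
measure on the disjoint union, and a tuple of measure preserving maps pulls kernels back by a linear
isometry. If one tuple of spaces maps to both P and Q, the two pulled-back kernels lie in one
Hilbert space, and half the distance between them depends only on the joint law, which is a
coupling. So the network distance is the least such half-distance. It is attained
(`exists_networkDist_eq`): couplings form a weakly compact set by Prokhorov, and the distortion is
continuous on it.

Couplings sharing a marginal glue over it by disintegration (`exists_glue`), so finitely many
networks can be compared inside one Hilbert space. Gluing gives the triangle inequality. At distance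
zero an optimal coupling makes the two pullbacks equal, and this common kernel defines the third
network that weak isomorphism asks for.

The geometry is then inherited from the cone of nonnegative kernels. Convexity of the cone turns
segments between optimally coupled kernels into geodesics. For curvature, optimal couplings of γ(t)
with the endpoints and with the test point are glued over γ(t). Equality in the triangle inequality
puts the kernel of γ(t) on the Hilbert segment, where the comparison is an identity; the remaining
distances are only bounded by norms, in the favourable direction. For completeness, infinitely many
couplings are glued along a Markov chain (`exists_glue_seq`), and the Cauchy sequence converges in
one `L2`. -/

/-! ### Blockwise analysis on the disjoint union -/

section Sigma

variable {k : ℕ} {X : Fin k → Type u} [∀ i, MeasurableSpace (X i)]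

theorem measurableEmbedding_sigmaMk (i : Fin k) :
    MeasurableEmbedding (Sigma.mk i : X i → Σ i, X i) where
  injective := sigma_mk_injective
  measurable := PartitionedMeasureNetwork.measurable_sigmaMk i
  measurableSet_image' := by
    intro s hs
    refine MeasurableSpace.measurableSet_iInf.2 fun j => ?_
    change MeasurableSet (Sigma.mk j ⁻¹' (Sigma.mk i '' s))
    by_cases h : i = j
    · subst h
      rwa [Set.preimage_image_eq _ sigma_mk_injective]
    · rw [Set.preimage_image_sigmaMk_of_ne (Ne.symm h)]
      exact MeasurableSet.empty

theorem sigmaMeasure_prod (μ : ∀ i, Measure (X i)) [∀ i, SFinite (μ i)] :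
    (sigmaMeasure μ).prod (sigmaMeasure μ) = Measure.sum fun p : Fin k × Fin k =>
      ((μ p.1).prod (μ p.2)).map (Prod.map (Sigma.mk p.1) (Sigma.mk p.2)) := by
  unfold sigmaMeasure
  rw [Measure.prod_sum]
  congr 1
  funext p
  exact Measure.map_prod_map _ _ (PartitionedMeasureNetwork.measurable_sigmaMk _)
    (PartitionedMeasureNetwork.measurable_sigmaMk _)

theorem ae_sigmaMeasure_prod_iff (μ : ∀ i, Measure (X i)) [∀ i, SFinite (μ i)]
    {p : (Σ i, X i) × (Σ i, X i) → Prop} :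
    (∀ᵐ z ∂(sigmaMeasure μ).prod (sigmaMeasure μ), p z) ↔
      ∀ i j, ∀ᵐ z ∂(μ i).prod (μ j), p (⟨i, z.1⟩, ⟨j, z.2⟩) := by
  rw [sigmaMeasure_prod, Measure.ae_sum_iff, Prod.forall]
  refine forall₂_congr fun i j => ?_
  rw [((measurableEmbedding_sigmaMk i).prodMap (measurableEmbedding_sigmaMk j)).ae_map_iff]
  rfl

/-- This turns the double sum of block distortions into a single Hilbert space norm. -/
theorem eLpNorm_sigmaMeasure_prod (μ : ∀ i, Measure (X i)) [∀ i, SFinite (μ i)]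
    (f : (Σ i, X i) × (Σ i, X i) → ℝ) :
    eLpNorm f 2 ((sigmaMeasure μ).prod (sigmaMeasure μ)) =
      (∑ i, ∑ j, eLpNorm (fun z : X i × X j => f (⟨i, z.1⟩, ⟨j, z.2⟩)) 2
        ((μ i).prod (μ j)) ^ 2) ^ (1 / 2 : ℝ) := by
  have key : ∀ {α : Type u} [MeasurableSpace α] (ν : Measure α) (g : α → ℝ),
      eLpNorm g 2 ν = (∫⁻ x, ‖g x‖ₑ ^ 2 ∂ν) ^ (1 / 2 : ℝ) := by
    intro α _ ν g
    rw [eLpNorm_eq_lintegral_rpow_enorm_toReal (by norm_num) (by norm_num)]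
    norm_num
  have key2 : ∀ {α : Type u} [MeasurableSpace α] (ν : Measure α) (g : α → ℝ),
      eLpNorm g 2 ν ^ 2 = ∫⁻ x, ‖g x‖ₑ ^ 2 ∂ν := by
    intro α _ ν g
    rw [key, ← ENNReal.rpow_natCast, ← ENNReal.rpow_mul]
    norm_num
  rw [key, sigmaMeasure_prod, lintegral_sum_measure, tsum_fintype, Fintype.sum_prod_type]
  congr 1
  refine Finset.sum_congr rfl fun i _ => Finset.sum_congr rfl fun j _ => ?_
  rw [((measurableEmbedding_sigmaMk i).prodMap (measurableEmbedding_sigmaMk j)).lintegral_map,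
    key2]
  rfl

end Sigma

/-! ### Tuples of standard Borel probability spaces and their square integrable kernels -/

/-- A `k`-tuple of standard Borel probability spaces. -/
structure BlockSpace (k : ℕ) : Type (u + 1) where
  X : Fin k → Type u
  [meas : ∀ i, MeasurableSpace (X i)]
  [standardBorel : ∀ i, StandardBorelSpace (X i)]
  μ : ∀ i, Measure (X i)
  [prob : ∀ i, IsProbabilityMeasure (μ i)]

namespace BlockSpace

attribute [instance] meas standardBorel prob

variable {k : ℕ}

/-- The square of the sum of the block measures, on pairs of points of the disjoint union. -/
noncomputable abbrev pairMeasure (A : BlockSpace.{u} k) : Measure ((Σ i, A.X i) × (Σ i, A.X i)) :=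
  (sigmaMeasure A.μ).prod (sigmaMeasure A.μ)

/-- Square integrable kernels on a tuple of probability spaces. -/
abbrev L2 (A : BlockSpace.{u} k) : Type u := Lp ℝ 2 A.pairMeasure

theorem smul_nonneg {A : BlockSpace.{u} k} {c : ℝ} (hc : 0 ≤ c) {K : A.L2} (hK : 0 ≤ K) :
    0 ≤ c • K := by
  rw [← Lp.coeFn_nonneg] at hK ⊢
  filter_upwards [hK, Lp.coeFn_smul c K] with z h₁ h₂
  rw [h₂]
  exact mul_nonneg hc h₁

/-- Tuples of measure preserving maps. -/
structure Hom (A B : BlockSpace.{u} k) where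
  toFun : ∀ i, A.X i → B.X i
  measurePreserving : ∀ i, MeasurePreserving (toFun i) (A.μ i) (B.μ i)

/-- The identity maps. -/
def Hom.id (A : BlockSpace.{u} k) : Hom A A := ⟨fun _ => _root_.id, fun _ => .id _⟩

/-- Blockwise composition. -/
def Hom.comp {A B C : BlockSpace.{u} k} (g : Hom B C) (f : Hom A B) : Hom A C :=
  ⟨fun i => g.toFun i ∘ f.toFun i, fun i => (g.measurePreserving i).comp (f.measurePreserving i)⟩

namespace Hom

variable {A B C : BlockSpace.{u} k}

/-- The map induced on pairs of points of the disjoint unions. -/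
def pairMap (f : Hom A B) : (Σ i, A.X i) × (Σ i, A.X i) → (Σ i, B.X i) × (Σ i, B.X i) :=
  Prod.map (Sigma.map _root_.id f.toFun) (Sigma.map _root_.id f.toFun)

theorem measurePreserving_pairMap (f : Hom A B) :
    MeasurePreserving f.pairMap A.pairMeasure B.pairMeasure :=
  have h := PartitionedMeasureNetwork.measurePreserving_sigmaMap _ _ _ f.measurePreserving
  h.prod h

/-- Pullback of kernels along measure preserving maps. -/
noncomputable def pull (f : Hom A B) : B.L2 →ₗᵢ[ℝ] A.L2 :=
  Lp.compMeasurePreservingₗᵢ ℝ f.pairMap f.measurePreserving_pairMap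

theorem coeFn_pull (f : Hom A B) (K : B.L2) :
    f.pull K =ᵐ[A.pairMeasure] K ∘ f.pairMap :=
  Lp.coeFn_compMeasurePreserving K f.measurePreserving_pairMap

theorem pull_comp (g : Hom B C) (f : Hom A B) (K : C.L2) :
    (g.comp f).pull K = f.pull (g.pull K) := by
  apply Lp.ext
  refine ((g.comp f).coeFn_pull K).trans ((f.coeFn_pull _).trans ?_).symm
  filter_upwards [f.measurePreserving_pairMap.quasiMeasurePreserving.ae (g.coeFn_pull K)] with z hz
  exact hz

theorem pull_id (K : A.L2) : (Hom.id A).pull K = K := by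
  apply Lp.ext
  exact ((Hom.id A).coeFn_pull K).trans (Filter.Eventually.of_forall fun _ => rfl)

/-- Needed for gluing, where the two composites to the shared space agree only almost everywhere. -/
theorem pull_congr {f g : Hom A B} (h : ∀ i, f.toFun i =ᵐ[A.μ i] g.toFun i) (K : B.L2) :
    f.pull K = g.pull K := by
  apply Lp.ext
  refine (f.coeFn_pull K).trans (Filter.EventuallyEq.trans ?_ (g.coeFn_pull K).symm)
  refine (ae_sigmaMeasure_prod_iff A.μ).2 fun i j => ?_
  filter_upwards [(Measure.quasiMeasurePreserving_fst (μ := A.μ i) (ν := A.μ j)).ae (h i),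
    (Measure.quasiMeasurePreserving_snd (μ := A.μ i) (ν := A.μ j)).ae (h j)] with z h1 h2
  simp only [Function.comp_apply, pairMap, Prod.map_apply, Sigma.map, h1, h2]

theorem pull_nonneg (f : Hom A B) {K : B.L2} (hK : 0 ≤ K) : 0 ≤ f.pull K := by
  rw [← Lp.coeFn_nonneg] at hK ⊢
  filter_upwards [f.coeFn_pull K, f.measurePreserving_pairMap.quasiMeasurePreserving.ae hK]
    with z h1 h2
  rw [h1]
  exact h2

end Hom

/-! ### Couplings -/

/-- The products of the blocks, with a prescribed tuple of measures. -/
def ofProd (A B : BlockSpace.{u} k) (π : ∀ i, Measure (A.X i × B.X i))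
    [∀ i, IsProbabilityMeasure (π i)] : BlockSpace.{u} k where
  X i := A.X i × B.X i
  μ := π

/-- The joint law of two tuples of measure preserving maps. -/
noncomputable def jointLaw {A B C : BlockSpace.{u} k} (f : Hom C A) (g : Hom C B) (i : Fin k) :
    Measure (A.X i × B.X i) :=
  (C.μ i).map fun x => (f.toFun i x, g.toFun i x)

section Joint

variable {A B C : BlockSpace.{u} k} (f : Hom C A) (g : Hom C B)

theorem measurePreserving_joint (i : Fin k) :
    MeasurePreserving (fun x => (f.toFun i x, g.toFun i x)) (C.μ i) (jointLaw f g i) :=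
  ((f.measurePreserving i).measurable.prodMk (g.measurePreserving i).measurable).measurePreserving _

instance (i : Fin k) : IsProbabilityMeasure (jointLaw f g i) :=
  Measure.isProbabilityMeasure_map (measurePreserving_joint f g i).aemeasurable

theorem map_fst_jointLaw (i : Fin k) : (jointLaw f g i).map Prod.fst = A.μ i := by
  rw [jointLaw, Measure.map_map measurable_fst (measurePreserving_joint f g i).measurable]
  exact (f.measurePreserving i).map_eq

theorem map_snd_jointLaw (i : Fin k) : (jointLaw f g i).map Prod.snd = B.μ i := by
  rw [jointLaw, Measure.map_map measurable_snd (measurePreserving_joint f g i).measurable]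
  exact (g.measurePreserving i).map_eq

end Joint

namespace Hom

variable {A B C : BlockSpace.{u} k}

/-- First projections of a coupling. -/
def fst (π : ∀ i, Measure (A.X i × B.X i)) [∀ i, IsProbabilityMeasure (π i)]
    (h : ∀ i, (π i).map Prod.fst = A.μ i) : Hom (ofProd A B π) A :=
  ⟨fun _ => Prod.fst, fun i => ⟨measurable_fst, h i⟩⟩

/-- Second projections of a coupling. -/
def snd (π : ∀ i, Measure (A.X i × B.X i)) [∀ i, IsProbabilityMeasure (π i)]
    (h : ∀ i, (π i).map Prod.snd = B.μ i) : Hom (ofProd A B π) B :=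
  ⟨fun _ => Prod.snd, fun i => ⟨measurable_snd, h i⟩⟩

/-- Distances between pullbacks depend only on the joint law. -/
theorem norm_pull_sub_pull (f : Hom C A) (g : Hom C B) (π : ∀ i, Measure (A.X i × B.X i))
    [∀ i, IsProbabilityMeasure (π i)] (hπ : ∀ i, jointLaw f g i = π i)
    (h₁ : ∀ i, (π i).map Prod.fst = A.μ i) (h₂ : ∀ i, (π i).map Prod.snd = B.μ i)
    (K : A.L2) (L : B.L2) :
    ‖f.pull K - g.pull L‖ = ‖(fst π h₁).pull K - (snd π h₂).pull L‖ := by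
  let j : Hom C (ofProd A B π) :=
    ⟨fun i x => (f.toFun i x, g.toFun i x), fun i =>
      ⟨(measurePreserving_joint f g i).measurable, hπ i⟩⟩
  have e₁ : f.pull K = j.pull ((fst π h₁).pull K) := pull_comp (fst π h₁) j K
  have e₂ : g.pull L = j.pull ((snd π h₂).pull L) := pull_comp (snd π h₂) j L
  rw [e₁, e₂, ← map_sub, LinearIsometry.norm_map]

end Hom

/-- Two tuples of measure preserving maps with the same target can be glued. -/
theorem exists_glue {A B C : BlockSpace.{u} k} (f : Hom B A) (g : Hom C A) :
    ∃ (D : BlockSpace.{u} k) (f' : Hom D B) (g' : Hom D C),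
      ∀ K : A.L2, f'.pull (f.pull K) = g'.pull (g.pull K) := by
  choose τ hτ h₁ h₂ he using fun i =>
    PartitionedMeasureNetwork.exists_gluing (B.μ i) (C.μ i) (A.μ i) (f.toFun i) (g.toFun i)
      (f.measurePreserving i) (g.measurePreserving i)
  refine ⟨ofProd B C τ, ⟨fun _ => Prod.fst, h₁⟩, ⟨fun _ => Prod.snd, h₂⟩, fun K => ?_⟩
  rw [← Hom.pull_comp, ← Hom.pull_comp]
  exact Hom.pull_congr he K

end BlockSpace

namespace PartitionedMeasureNetwork

variable {k : ℕ}

/-- The probability spaces underlying a network. -/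
abbrev space (P : PartitionedMeasureNetwork.{u} k) : BlockSpace.{u} k where
  X := P.X
  μ := P.μ

/-- The kernel of a network as a square integrable function. -/
noncomputable def kernel (P : PartitionedMeasureNetwork.{u} k) : P.space.L2 :=
  P.ω_memLp.toLp _

theorem coeFn_kernel (P : PartitionedMeasureNetwork.{u} k) :
    P.kernel =ᵐ[P.space.pairMeasure] fun z => P.ω z.1 z.2 :=
  P.ω_memLp.coeFn_toLp

theorem kernel_nonneg (P : PartitionedMeasureNetwork.{u} k) : 0 ≤ P.kernel := by
  rw [← Lp.coeFn_nonneg]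
  filter_upwards [P.coeFn_kernel] with z hz
  rw [hz]
  exact P.ω_nonneg _ _

theorem coeFn_pull_kernel (P : PartitionedMeasureNetwork.{u} k) {C : BlockSpace.{u} k}
    (f : C.Hom P.space) : f.pull P.kernel =ᵐ[C.pairMeasure] fun z =>
      P.ω (f.pairMap z).1 (f.pairMap z).2 :=
  (f.coeFn_pull _).trans (f.measurePreserving_pairMap.quasiMeasurePreserving.ae P.coeFn_kernel)

/-- The network with a given nonnegative kernel. -/
noncomputable def ofKernel (A : BlockSpace.{u} k) (K : A.L2) :
    PartitionedMeasureNetwork.{u} k :=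
  -- Only the Borel structure matters, so any compatible Polish topology will do.
  letI := fun i => upgradeStandardBorel (A.X i)
  { X := A.X
    μ := A.μ
    -- A network kernel must be nonnegative everywhere, whereas `0 ≤ K` holds only almost
    -- everywhere.
    ω := fun x y => |K (x, y)|
    ω_nonneg := fun _ _ => abs_nonneg _
    ω_memLp := (Lp.memLp K).abs }

theorem kernel_ofKernel (A : BlockSpace.{u} k) {K : A.L2} (hK : 0 ≤ K) :
    (ofKernel A K).kernel = K := by
  apply Lp.ext
  refine (ofKernel A K).coeFn_kernel.trans ?_
  filter_upwards [(Lp.coeFn_nonneg K).2 hK] with z hz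
  exact abs_of_nonneg hz

theorem pull_id_kernel_ofKernel (A : BlockSpace.{u} k) {K : A.L2} (hK : 0 ≤ K) :
    BlockSpace.Hom.pull (B := (ofKernel A K).space) (BlockSpace.Hom.id A)
      (ofKernel A K).kernel = K :=
  (BlockSpace.Hom.pull_id _).trans (kernel_ofKernel A hK)

/-! ### The distance through couplings -/

theorem enorm_fst_pull_sub_snd_pull (P Q : PartitionedMeasureNetwork.{u} k)
    (π : ∀ i, Measure (P.space.X i × Q.space.X i)) [∀ i, IsProbabilityMeasure (π i)]
    (h₁ : ∀ i, (π i).map Prod.fst = P.space.μ i) (h₂ : ∀ i, (π i).map Prod.snd = Q.space.μ i) :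
    ‖(BlockSpace.Hom.fst (A := P.space) (B := Q.space) π h₁).pull P.kernel -
        (BlockSpace.Hom.snd (A := P.space) (B := Q.space) π h₂).pull Q.kernel‖ₑ =
      (∑ i, ∑ j, blockDistortion P Q π i j ^ 2) ^ (1 / 2 : ℝ) := by
  rw [Lp.enorm_def]
  unfold blockDistortion
  refine (eLpNorm_congr_ae ?_).trans (eLpNorm_sigmaMeasure_prod π fun z =>
    P.ω (Sigma.map id (fun _ => Prod.fst) z.1) (Sigma.map id (fun _ => Prod.fst) z.2) -
    Q.ω (Sigma.map id (fun _ => Prod.snd) z.1) (Sigma.map id (fun _ => Prod.snd) z.2))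
  refine (Lp.coeFn_sub _ _).trans ?_
  exact (P.coeFn_pull_kernel _).sub (Q.coeFn_pull_kernel _)

theorem isProbabilityMeasure_of_mem_partitionedCouplings {P Q : PartitionedMeasureNetwork.{u} k}
    {π : ∀ i, Measure (P.X i × Q.X i)} (hπ : π ∈ partitionedCouplings P Q) (i : Fin k) :
    IsProbabilityMeasure (π i) := by
  have h : IsProbabilityMeasure ((π i).map Prod.fst) := (hπ i).1 ▸ P.prob i
  exact Measure.isProbabilityMeasure_of_map Prod.fst

/-- Any common source of the two networks bounds the distance: the joint law of its maps is a
coupling and determines the norm. -/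
theorem networkDist_le {P Q : PartitionedMeasureNetwork.{u} k} {C : BlockSpace.{u} k}
    (f : C.Hom P.space) (g : C.Hom Q.space) :
    networkDist P Q ≤ ENNReal.ofReal (1 / 2 * ‖f.pull P.kernel - g.pull Q.kernel‖) := by
  have hmem : BlockSpace.jointLaw f g ∈ partitionedCouplings P Q := fun i =>
    ⟨BlockSpace.map_fst_jointLaw f g i, BlockSpace.map_snd_jointLaw f g i⟩
  refine (iInf₂_le _ hmem).trans (le_of_eq ?_)
  have hp := isProbabilityMeasure_of_mem_partitionedCouplings hmem
  rw [f.norm_pull_sub_pull g (BlockSpace.jointLaw f g) (fun _ => rfl) (fun i => (hmem i).1)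
    (fun i => (hmem i).2), ENNReal.ofReal_mul (by norm_num), ofReal_norm,
    ← enorm_fst_pull_sub_snd_pull P Q _ (fun i => (hmem i).1) (fun i => (hmem i).2)]
  congr 1
  rw [ENNReal.ofReal_div_of_pos (by norm_num)]
  norm_num

/-! ### Existence of optimal couplings -/

/-- The set of couplings of two probability measures. -/
def couplings {X Y : Type u} [MeasurableSpace X] [MeasurableSpace Y] (μ : Measure X)
    (ν : Measure Y) : Set (ProbabilityMeasure (X × Y)) :=
  {π | (π : Measure (X × Y)).map Prod.fst = μ ∧ (π : Measure (X × Y)).map Prod.snd = ν}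

theorem couplings_nonempty {X Y : Type u} [MeasurableSpace X] [MeasurableSpace Y] (μ : Measure X)
    (ν : Measure Y) [IsProbabilityMeasure μ] [IsProbabilityMeasure ν] :
    (couplings μ ν).Nonempty :=
  ⟨⟨μ.prod ν, inferInstance⟩, Measure.fst_prod, Measure.snd_prod⟩

theorem dist_toReal_eLpNorm_sub_le {α : Type u} [MeasurableSpace α] {μ : Measure α}
    {a b a' b' : α → ℝ} (ha : MemLp a 2 μ) (hb : MemLp b 2 μ) (ha' : MemLp a' 2 μ)
    (hb' : MemLp b' 2 μ) :
    dist (eLpNorm (a - b) 2 μ).toReal (eLpNorm (a' - b') 2 μ).toReal ≤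
      (eLpNorm (a - a') 2 μ).toReal + (eLpNorm (b - b') 2 μ).toReal := by
  have e : ∀ {s t : α → ℝ} (hs : MemLp s 2 μ) (ht : MemLp t 2 μ),
      (eLpNorm (s - t) 2 μ).toReal = ‖hs.toLp - ht.toLp‖ := fun hs ht => by
    rw [← MemLp.toLp_sub, Lp.norm_toLp]
  rw [e ha hb, e ha' hb', e ha ha', e hb hb', Real.dist_eq]
  calc _ ≤ ‖(ha.toLp - hb.toLp) - (ha'.toLp - hb'.toLp)‖ := abs_norm_sub_norm_le _ _
    _ = ‖(ha.toLp - ha'.toLp) - (hb.toLp - hb'.toLp)‖ := by congr 1; abel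
    _ ≤ _ := norm_sub_le _ _

/-! ### Weak compactness of coupling sets and continuity of the distortion. -/

section Couplings

variable {X Y X' Y' : Type u} [TopologicalSpace X] [PolishSpace X] [MeasurableSpace X]
  [BorelSpace X] [TopologicalSpace Y] [PolishSpace Y] [MeasurableSpace Y] [BorelSpace Y]
  [TopologicalSpace X'] [PolishSpace X'] [MeasurableSpace X'] [BorelSpace X']
  [TopologicalSpace Y'] [PolishSpace Y'] [MeasurableSpace Y'] [BorelSpace Y']
  (μ : Measure X) [IsProbabilityMeasure μ] (ν : Measure Y) [IsProbabilityMeasure ν]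
  (μ' : Measure X') [IsProbabilityMeasure μ'] (ν' : Measure Y') [IsProbabilityMeasure ν']

theorem isClosed_couplings : IsClosed (couplings μ ν) := by
  let m : ProbabilityMeasure X := ⟨μ, inferInstance⟩
  let n : ProbabilityMeasure Y := ⟨ν, inferInstance⟩
  have h₁ := ProbabilityMeasure.continuous_map (continuous_fst (X := X) (Y := Y))
  have h₂ := ProbabilityMeasure.continuous_map (continuous_snd (X := X) (Y := Y))
  convert! (isClosed_singleton (x := m)).preimage h₁ |>.inter
    ((isClosed_singleton (x := n)).preimage h₂) using 1
  ext π
  exact and_congr (Subtype.ext_iff (a1 := π.map measurable_fst.aemeasurable) (a2 := m)).symm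
    (Subtype.ext_iff (a1 := π.map measurable_snd.aemeasurable) (a2 := n)).symm

/-- Prokhorov: if K and L carry all but ε/2 of the two marginals, then K × L carries all but ε of
every coupling. -/
theorem isCompact_couplings : IsCompact (couplings μ ν) := by
  rw [← (isClosed_couplings μ ν).closure_eq]
  refine isCompact_closure_of_isTightMeasureSet ?_
  rw [isTightMeasureSet_iff_exists_isCompact_measure_compl_le]
  intro ε hε
  have hε2 : 0 < ε / 2 := ENNReal.half_pos hε.ne'
  obtain ⟨K, hK, hμK⟩ := isTightMeasureSet_iff_exists_isCompact_measure_compl_le.1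
    (isTightMeasureSet_singleton (μ := μ)) _ hε2
  obtain ⟨L, hL, hνL⟩ := isTightMeasureSet_iff_exists_isCompact_measure_compl_le.1
    (isTightMeasureSet_singleton (μ := ν)) _ hε2
  refine ⟨K ×ˢ L, hK.prod hL, ?_⟩
  rintro _ ⟨π, hπ, rfl⟩
  rw [Set.compl_prod_eq_union]
  refine (measure_union_le _ _).trans ?_
  rw [← ENNReal.add_halves ε]
  refine add_le_add ?_ ?_
  · have h := hμK μ rfl
    rw [← hπ.1, Measure.map_apply measurable_fst hK.measurableSet.compl] at h
    rwa [Set.prod_univ]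
  · have h := hνL ν rfl
    rw [← hπ.2, Measure.map_apply measurable_snd hL.measurableSet.compl] at h
    rwa [Set.univ_prod]

/-- The `L²` distortion depends continuously on the couplings: it is a uniform limit of
distortions of bounded continuous kernels. -/
theorem continuousOn_eLpNorm_sub {f : X × X' → ℝ} {g : Y × Y' → ℝ}
    (hf : MemLp f 2 (μ.prod μ')) (hg : MemLp g 2 (ν.prod ν')) :
    ContinuousOn (fun π : ProbabilityMeasure (X × Y) × ProbabilityMeasure (X' × Y') =>
      (eLpNorm (fun z : (X × Y) × (X' × Y') => f (z.1.1, z.2.1) - g (z.1.2, z.2.2)) 2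
        ((π.1 : Measure (X × Y)).prod (π.2 : Measure (X' × Y')))).toReal)
      (couplings μ ν ×ˢ couplings μ' ν') := by
  refine continuousOn_of_uniform_approx_of_continuousOn fun U hU => ?_
  obtain ⟨ε, hε, hεU⟩ := Metric.mem_uniformity_dist.1 hU
  have hε4 : ENNReal.ofReal (ε / 4) ≠ 0 := by simpa using hε
  obtain ⟨f', hf', hfm'⟩ := hf.exists_boundedContinuous_eLpNorm_sub_le (by norm_num) hε4
  obtain ⟨g', hg', hgm'⟩ := hg.exists_boundedContinuous_eLpNorm_sub_le (by norm_num) hε4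
  refine ⟨fun π => (eLpNorm (fun z : (X × Y) × (X' × Y') =>
    f' (z.1.1, z.2.1) - g' (z.1.2, z.2.2)) 2
        ((π.1 : Measure (X × Y)).prod (π.2 : Measure (X' × Y')))).toReal, ?_, ?_⟩
  · refine Continuous.continuousOn ?_
    let p : C((X × Y) × (X' × Y'), X × X') := ⟨fun z => (z.1.1, z.2.1), by fun_prop⟩
    let q : C((X × Y) × (X' × Y'), Y × Y') := ⟨fun z => (z.1.2, z.2.2), by fun_prop⟩
    -- The squared norm of `h` is the integral of the bounded continuous function `h * h`, and the
    -- product of probability measures is weakly continuous.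
    let h : BoundedContinuousFunction ((X × Y) × (X' × Y')) ℝ :=
      f'.compContinuous p - g'.compContinuous q
    have hc := (ProbabilityMeasure.continuous_integral_boundedContinuousFunction (h * h)).comp
      (ProbabilityMeasure.continuous_prod (α := X × Y) (β := X' × Y'))
    have hs := Real.continuous_sqrt.comp hc
    refine hs.congr fun π => ?_
    have hm : MemLp h 2 ((π.1 : Measure (X × Y)).prod (π.2 : Measure (X' × Y'))) :=
      MemLp.of_bound h.continuous.aestronglyMeasurable ‖h‖
        (Filter.Eventually.of_forall h.norm_coe_le_norm)
    have e := hm.eLpNorm_eq_integral_rpow_norm (by norm_num) (by norm_num)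
    change _ = (eLpNorm h 2 _).toReal
    rw [e, ENNReal.toReal_ofReal (by positivity)]
    simp only [Function.comp_apply, ProbabilityMeasure.toMeasure_prod, Real.sqrt_eq_rpow]
    norm_num
    simp [sq]
  · rintro ⟨π, π'⟩ ⟨hπ, hπ'⟩
    apply hεU
    -- The approximation error is uniform in the couplings, since it is computed on the fixed
    -- marginal products.
    have hp : MeasurePreserving (fun z : (X × Y) × (X' × Y') => (z.1.1, z.2.1))
        ((π : Measure (X × Y)).prod (π' : Measure (X' × Y'))) (μ.prod μ') :=
      MeasurePreserving.prod (f := Prod.fst) (g := Prod.fst) ⟨measurable_fst, hπ.1⟩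
        ⟨measurable_fst, hπ'.1⟩
    have hq : MeasurePreserving (fun z : (X × Y) × (X' × Y') => (z.1.2, z.2.2))
        ((π : Measure (X × Y)).prod (π' : Measure (X' × Y'))) (ν.prod ν') :=
      MeasurePreserving.prod (f := Prod.snd) (g := Prod.snd) ⟨measurable_snd, hπ.2⟩
        ⟨measurable_snd, hπ'.2⟩
    have a := hf.comp_measurePreserving hp
    have b := hg.comp_measurePreserving hq
    have a' := hfm'.comp_measurePreserving hp
    have b' := hgm'.comp_measurePreserving hq
    refine (dist_toReal_eLpNorm_sub_le a b a' b').trans_lt ?_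
    have da := (eLpNorm_comp_measurePreserving (hf.sub hfm').1 hp).trans_le hf'
    have db := (eLpNorm_comp_measurePreserving (hg.sub hgm').1 hq).trans_le hg'
    calc _ ≤ ε / 4 + ε / 4 := add_le_add
          (ENNReal.toReal_le_of_le_ofReal (by positivity) da)
          (ENNReal.toReal_le_of_le_ofReal (by positivity) db)
      _ < ε := by linarith

end Couplings

/-! ### Minimising the distortion over tuples of couplings. -/

theorem memLp_block (P : PartitionedMeasureNetwork.{u} k) (i j : Fin k) :
    MemLp (fun z : P.X i × P.X j => P.ω ⟨i, z.1⟩ ⟨j, z.2⟩) 2 ((P.μ i).prod (P.μ j)) := by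
  have h := P.ω_memLp
  rw [sigmaMeasure_prod] at h
  have h' := h.mono_measure (Measure.le_sum _ (i, j))
  exact (((measurableEmbedding_sigmaMk i).prodMap
    (measurableEmbedding_sigmaMk j)).memLp_map_measure_iff).1 h'

theorem blockDistortion_ne_top {P Q : PartitionedMeasureNetwork.{u} k}
    {π : ∀ i, Measure (P.X i × Q.X i)} (hπ : π ∈ partitionedCouplings P Q) (i j : Fin k) :
    blockDistortion P Q π i j ≠ ⊤ := by
  have hp := isProbabilityMeasure_of_mem_partitionedCouplings hπ
  have h₁ : MeasurePreserving (Prod.map Prod.fst Prod.fst) ((π i).prod (π j))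
      ((P.μ i).prod (P.μ j)) :=
    MeasurePreserving.prod ⟨measurable_fst, (hπ i).1⟩ ⟨measurable_fst, (hπ j).1⟩
  have h₂ : MeasurePreserving (Prod.map Prod.snd Prod.snd) ((π i).prod (π j))
      ((Q.μ i).prod (Q.μ j)) :=
    MeasurePreserving.prod ⟨measurable_snd, (hπ i).2⟩ ⟨measurable_snd, (hπ j).2⟩
  exact (((P.memLp_block i j).comp_measurePreserving h₁).sub
    ((Q.memLp_block i j).comp_measurePreserving h₂)).eLpNorm_ne_top

/-- The total squared distortion of a tuple of measures, as a real number. -/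
noncomputable def distortionSq (P Q : PartitionedMeasureNetwork.{u} k)
    (π : ∀ i, ProbabilityMeasure (P.X i × Q.X i)) : ℝ :=
  ∑ i, ∑ j, (blockDistortion P Q (fun i => (π i : Measure (P.X i × Q.X i))) i j).toReal ^ 2

theorem ofReal_distortionSq {P Q : PartitionedMeasureNetwork.{u} k}
    {π : ∀ i, ProbabilityMeasure (P.X i × Q.X i)}
    (hπ : (fun i => (π i : Measure (P.X i × Q.X i))) ∈ partitionedCouplings P Q) :
    ENNReal.ofReal (distortionSq P Q π) =
      ∑ i, ∑ j, blockDistortion P Q (fun i => (π i : Measure (P.X i × Q.X i))) i j ^ 2 := by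
  unfold distortionSq
  rw [ENNReal.ofReal_sum_of_nonneg fun i _ => Finset.sum_nonneg fun j _ => sq_nonneg _]
  refine Finset.sum_congr rfl fun i _ => ?_
  rw [ENNReal.ofReal_sum_of_nonneg fun j _ => sq_nonneg _]
  refine Finset.sum_congr rfl fun j _ => ?_
  rw [ENNReal.ofReal_pow ENNReal.toReal_nonneg,
    ENNReal.ofReal_toReal (blockDistortion_ne_top hπ i j)]

theorem continuousOn_distortionSq (P Q : PartitionedMeasureNetwork.{u} k) :
    ContinuousOn (distortionSq P Q) (Set.univ.pi fun i => couplings (P.μ i) (Q.μ i)) := by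
  unfold distortionSq
  refine continuousOn_finsetSum _ fun i _ => continuousOn_finsetSum _ fun j _ =>
    ContinuousOn.pow ?_ 2
  have h := continuousOn_eLpNorm_sub (P.μ i) (Q.μ i) (P.μ j) (Q.μ j) (P.memLp_block i j)
    (Q.memLp_block i j)
  exact h.comp (f := fun π : ∀ i, ProbabilityMeasure (P.X i × Q.X i) => (π i, π j))
    (Continuous.continuousOn (by fun_prop)) fun π hπ =>
      ⟨hπ i (Set.mem_univ i), hπ j (Set.mem_univ j)⟩

theorem exists_networkDist_eq (P Q : PartitionedMeasureNetwork.{u} k) :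
    ∃ (C : BlockSpace.{u} k) (f : C.Hom P.space) (g : C.Hom Q.space),
      networkDist P Q = ENNReal.ofReal (1 / 2 * ‖f.pull P.kernel - g.pull Q.kernel‖) := by
  obtain ⟨π, hπ, hmin⟩ := (isCompact_univ_pi fun i =>
    isCompact_couplings (P.μ i) (Q.μ i)).exists_isMinOn
    (Set.univ_pi_nonempty_iff.2 fun i => couplings_nonempty (P.μ i) (Q.μ i))
    (continuousOn_distortionSq P Q)
  have hmem : (fun i => (π i : Measure (P.X i × Q.X i))) ∈ partitionedCouplings P Q :=
    fun i => hπ i (Set.mem_univ i)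
  let f := BlockSpace.Hom.fst (A := P.space) (B := Q.space)
    (fun i => (π i : Measure (P.X i × Q.X i))) fun i => (hmem i).1
  let g := BlockSpace.Hom.snd (A := P.space) (B := Q.space)
    (fun i => (π i : Measure (P.X i × Q.X i))) fun i => (hmem i).2
  refine ⟨_, f, g, le_antisymm (networkDist_le f g) (le_iInf₂ fun ρ hρ => ?_)⟩
  have hp := isProbabilityMeasure_of_mem_partitionedCouplings hρ
  let ρ' : ∀ i, ProbabilityMeasure (P.X i × Q.X i) := fun i => ⟨ρ i, hp i⟩
  have hle := ENNReal.ofReal_le_ofReal (hmin (a := ρ') fun i _ => hρ i)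
  rw [ofReal_distortionSq hmem, ofReal_distortionSq (π := ρ') hρ] at hle
  rw [ENNReal.ofReal_mul (by norm_num), ofReal_norm,
    enorm_fst_pull_sub_snd_pull P Q _ (fun i => (hmem i).1) (fun i => (hmem i).2),
    ENNReal.ofReal_div_of_pos (by norm_num)]
  norm_num only [ENNReal.ofReal_one, ENNReal.ofReal_ofNat]
  exact mul_le_mul_right (ENNReal.rpow_le_rpow hle (by norm_num)) _

end PartitionedMeasureNetwork

namespace PartitionedMeasureNetwork

variable {k : ℕ}

/-! ### The distance as a real number -/

/-- The network distance as a real number. -/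
noncomputable def realDist (P Q : PartitionedMeasureNetwork.{u} k) : ℝ := (networkDist P Q).toReal

theorem networkDist_ne_top (P Q : PartitionedMeasureNetwork.{u} k) : networkDist P Q ≠ ⊤ := by
  obtain ⟨C, f, g, h⟩ := exists_networkDist_eq P Q
  exact h ▸ ENNReal.ofReal_ne_top

theorem realDist_nonneg (P Q : PartitionedMeasureNetwork.{u} k) : 0 ≤ realDist P Q :=
  ENNReal.toReal_nonneg

theorem realDist_le {P Q : PartitionedMeasureNetwork.{u} k} {C : BlockSpace.{u} k}
    (f : C.Hom P.space) (g : C.Hom Q.space) :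
    realDist P Q ≤ 1 / 2 * ‖f.pull P.kernel - g.pull Q.kernel‖ :=
  ENNReal.toReal_le_of_le_ofReal (by positivity) (networkDist_le f g)

theorem exists_realDist_eq (P Q : PartitionedMeasureNetwork.{u} k) :
    ∃ (C : BlockSpace.{u} k) (f : C.Hom P.space) (g : C.Hom Q.space),
      realDist P Q = 1 / 2 * ‖f.pull P.kernel - g.pull Q.kernel‖ := by
  obtain ⟨C, f, g, h⟩ := exists_networkDist_eq P Q
  exact ⟨C, f, g, by rw [realDist, h, ENNReal.toReal_ofReal (by positivity)]⟩

theorem realDist_comm_le (P Q : PartitionedMeasureNetwork.{u} k) :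
    realDist P Q ≤ realDist Q P := by
  obtain ⟨C, f, g, h⟩ := exists_realDist_eq Q P
  rw [h, norm_sub_rev]
  exact realDist_le g f

theorem realDist_comm (P Q : PartitionedMeasureNetwork.{u} k) : realDist P Q = realDist Q P :=
  le_antisymm (realDist_comm_le P Q) (realDist_comm_le Q P)

/-- Optimal couplings of P, Q and of Q, R are glued over Q. The two pullbacks of the kernel of Q
then coincide, and the triangle inequality of the norm applies. -/
theorem realDist_triangle (P Q R : PartitionedMeasureNetwork.{u} k) :
    realDist P R ≤ realDist P Q + realDist Q R := by
  obtain ⟨C, f, g, h⟩ := exists_realDist_eq P Q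
  obtain ⟨C', f', g', h'⟩ := exists_realDist_eq Q R
  obtain ⟨D, a, b, hab⟩ := BlockSpace.exists_glue g f'
  refine (realDist_le (f.comp a) (g'.comp b)).trans ?_
  rw [BlockSpace.Hom.pull_comp, BlockSpace.Hom.pull_comp, h, h', ← a.pull.norm_map,
    ← b.pull.norm_map, map_sub, map_sub, ← hab]
  linarith [norm_sub_le_norm_sub_add_norm_sub (a.pull (f.pull P.kernel))
    (a.pull (g.pull Q.kernel)) (b.pull (g'.pull R.kernel))]

/-! ### Weak isomorphism as vanishing of the distance -/

theorem pull_kernel_eq_kernel_of_isWeakIsomorphism {P R : PartitionedMeasureNetwork.{u} k}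
    {φ : ∀ i, R.X i → P.X i} (h : IsWeakIsomorphism R P φ) :
    BlockSpace.Hom.pull (A := R.space) (B := P.space) ⟨φ, h.1⟩ P.kernel = R.kernel := by
  apply Lp.ext
  refine (P.coeFn_pull_kernel (C := R.space) ⟨φ, h.1⟩).trans
    (Filter.EventuallyEq.trans ?_ R.coeFn_kernel.symm)
  refine (ae_sigmaMeasure_prod_iff R.μ).2 fun i j => ?_
  filter_upwards [h.2 i j] with z hz
  exact hz.symm

theorem isWeakIsomorphism_ofKernel {P : PartitionedMeasureNetwork.{u} k} {C : BlockSpace.{u} k}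
    (f : C.Hom P.space) {K : C.L2} (hK : f.pull P.kernel = K) :
    IsWeakIsomorphism (ofKernel C K) P f.toFun := by
  refine ⟨f.measurePreserving, (ae_sigmaMeasure_prod_iff C.μ (p := fun z => |K (z.1, z.2)| =
    P.ω (f.pairMap z).1 (f.pairMap z).2)).1 ?_⟩
  subst hK
  filter_upwards [P.coeFn_pull_kernel f] with z hz
  rw [hz, abs_of_nonneg (P.ω_nonneg _ _)]

/-- Attainment of the infimum is essential for the converse: it gives an actual equality of
pullbacks, hence a common network. -/
theorem weaklyIsomorphic_iff_realDist_eq_zero {P Q : PartitionedMeasureNetwork.{u} k} :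
    WeaklyIsomorphic P Q ↔ realDist P Q = 0 := by
  constructor
  · rintro ⟨R, φ, ψ, hφ, hψ⟩
    refine le_antisymm ?_ (realDist_nonneg P Q)
    refine (realDist_le (C := R.space) ⟨φ, hφ.1⟩ ⟨ψ, hψ.1⟩).trans ?_
    rw [pull_kernel_eq_kernel_of_isWeakIsomorphism hφ,
      pull_kernel_eq_kernel_of_isWeakIsomorphism hψ]
    simp
  · intro h
    obtain ⟨C, f, g, hfg⟩ := exists_realDist_eq P Q
    have h0 : ‖f.pull P.kernel - g.pull Q.kernel‖ = 0 := by linarith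
    have e : f.pull P.kernel = g.pull Q.kernel := sub_eq_zero.1 (norm_eq_zero.1 h0)
    exact ⟨ofKernel C (f.pull P.kernel), f.toFun, g.toFun, isWeakIsomorphism_ofKernel f rfl,
      isWeakIsomorphism_ofKernel g e.symm⟩

theorem realDist_congr {P P' Q Q' : PartitionedMeasureNetwork.{u} k} (h : WeaklyIsomorphic P P')
    (h' : WeaklyIsomorphic Q Q') : realDist P Q = realDist P' Q' := by
  rw [weaklyIsomorphic_iff_realDist_eq_zero] at h h'
  have h₁ := realDist_triangle P P' Q
  have h₂ := realDist_triangle P' Q' Q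
  have h₃ := realDist_triangle P' P Q'
  have h₄ := realDist_triangle P Q Q'
  rw [realDist_comm Q' Q] at h₂
  rw [realDist_comm P' P] at h₃
  linarith

theorem toClass_eq_iff {P Q : PartitionedMeasureNetwork.{u} k} :
    P.toClass = Q.toClass ↔ realDist P Q = 0 :=
  (Quotient.eq (r := weakIsomorphismSetoid.{u} k)).trans weaklyIsomorphic_iff_realDist_eq_zero

end PartitionedMeasureNetwork

open PartitionedMeasureNetwork

namespace NetworkClass

variable {k : ℕ}

theorem exists_rep (x : NetworkClass.{u} k) : ∃ P : PartitionedMeasureNetwork.{u} k,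
    P.toClass = x :=
  Quotient.exists_rep x

/-- The metric induced by the network distance on weak isomorphism classes. -/
noncomputable abbrev metricSpace (k : ℕ) : MetricSpace (NetworkClass.{u} k) where
  dist := Quotient.lift₂ realDist fun _ _ _ _ h h' => realDist_congr h h'
  dist_self x := by
    induction x using Quotient.inductionOn with | _ P
    exact toClass_eq_iff.1 rfl
  dist_comm x y := by
    induction x, y using Quotient.inductionOn₂ with | _ P Q
    exact realDist_comm P Q
  dist_triangle x y z := by
    induction x, y, z using Quotient.inductionOn₃ with | _ P Q R
    exact realDist_triangle P Q R
  eq_of_dist_eq_zero {x y} := by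
    induction x, y using Quotient.inductionOn₂ with | _ P Q
    exact toClass_eq_iff.2

attribute [local instance] metricSpace

theorem dist_toClass (P Q : PartitionedMeasureNetwork.{u} k) :
    dist P.toClass Q.toClass = realDist P Q := rfl

theorem edist_toClass (P Q : PartitionedMeasureNetwork.{u} k) :
    edist P.toClass Q.toClass = networkDist P Q := by
  rw [edist_dist, dist_toClass, realDist, ENNReal.ofReal_toReal (networkDist_ne_top P Q)]

theorem dist_ofKernel_le {C : BlockSpace.{u} k} {K L : C.L2} (hK : 0 ≤ K) (hL : 0 ≤ L) :
    dist (ofKernel C K).toClass (ofKernel C L).toClass ≤ 1 / 2 * ‖K - L‖ := by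
  have h := realDist_le (P := ofKernel C K) (Q := ofKernel C L) (BlockSpace.Hom.id C)
    (BlockSpace.Hom.id C)
  rwa [pull_id_kernel_ofKernel C hK, pull_id_kernel_ofKernel C hL] at h

/-- Allows a class to be represented on any space mapping to it, so that several classes live on one
space. -/
theorem toClass_ofKernel_pull {P : PartitionedMeasureNetwork.{u} k} {C : BlockSpace.{u} k}
    (f : C.Hom P.space) : (ofKernel C (f.pull P.kernel)).toClass = P.toClass := by
  rw [toClass_eq_iff, ← weaklyIsomorphic_iff_realDist_eq_zero]
  exact ⟨_, _, _, isWeakIsomorphism_ofKernel (P := ofKernel C (f.pull P.kernel))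
    (BlockSpace.Hom.id C) (pull_id_kernel_ofKernel C (f.pull_nonneg P.kernel_nonneg)),
    isWeakIsomorphism_ofKernel f rfl⟩

/-! ### Geodesics -/

/-- The upper bounds on [0, s], [s, t] and [t, 1] add up to the full distance, so none of them can
be strict. -/
theorem isGeodesic_of_dist_le {X : Type v} [MetricSpace X] {γ : Set.Icc (0 : ℝ) 1 → X} {x y : X}
    (h0 : γ 0 = x) (h1 : γ 1 = y)
    (h : ∀ s t : Set.Icc (0 : ℝ) 1, s ≤ t → dist (γ s) (γ t) ≤ ((t : ℝ) - s) * dist x y) :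
    IsGeodesic γ x y := by
  refine ⟨h0, h1, fun s t hst => le_antisymm (h s t hst) ?_⟩
  have a := h 0 s s.2.1
  have b := h t 1 t.2.2
  have c := dist_triangle4 (γ 0) (γ s) (γ t) (γ 1)
  rw [h0] at a c
  rw [h1] at b c
  simp only [Set.Icc.coe_zero, Set.Icc.coe_one] at a b
  linarith

theorem isGeodesicSpace (k : ℕ) : IsGeodesicSpace (NetworkClass.{u} k) := by
  intro x y
  obtain ⟨P, rfl⟩ := exists_rep x
  obtain ⟨Q, rfl⟩ := exists_rep y
  obtain ⟨C, f, g, h⟩ := exists_realDist_eq P Q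
  rw [← dist_toClass] at h
  set K := f.pull P.kernel with hKdef
  set L := g.pull Q.kernel with hLdef
  have hK : 0 ≤ K := f.pull_nonneg P.kernel_nonneg
  have hL : 0 ≤ L := g.pull_nonneg Q.kernel_nonneg
  have hpos : ∀ t : Set.Icc (0 : ℝ) 1, 0 ≤ (1 - (t : ℝ)) • K + (t : ℝ) • L := fun t =>
    add_nonneg
    (BlockSpace.smul_nonneg (sub_nonneg.2 t.2.2) hK) (BlockSpace.smul_nonneg t.2.1 hL)
  refine ⟨fun t => (ofKernel C ((1 - (t : ℝ)) • K + (t : ℝ) • L)).toClass,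
    isGeodesic_of_dist_le ?_ ?_ fun s t hst => ?_⟩
  · simpa using toClass_ofKernel_pull f
  · simpa using toClass_ofKernel_pull g
  · refine (dist_ofKernel_le (hpos s) (hpos t)).trans (le_of_eq ?_)
    have e : (1 - (s : ℝ)) • K + (s : ℝ) • L - ((1 - (t : ℝ)) • K + (t : ℝ) • L) =
        ((t : ℝ) - s) • (K - L) := by module
    rw [e, norm_smul, Real.norm_of_nonneg (sub_nonneg.2 hst), h]
    ring

/-! ### Curvature -/

theorem norm_sq_convex_combination {E : Type v} [NormedAddCommGroup E] [InnerProductSpace ℝ E]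
    (a b : E) (t : ℝ) : ‖(1 - t) • a + t • b‖ ^ 2 =
      (1 - t) * ‖a‖ ^ 2 + t * ‖b‖ ^ 2 - t * (1 - t) * ‖a - b‖ ^ 2 := by
  rw [norm_add_sq_real, norm_sub_sq_real, norm_smul, norm_smul, inner_smul_left, inner_smul_right]
  simp only [mul_pow, Real.norm_eq_abs, sq_abs, RCLike.conj_to_real]
  ring

/-- In a Hilbert space a point at which the triangle inequality is an equality is a convex
combination. -/
theorem eq_convex_combination {E : Type v} [NormedAddCommGroup E] [InnerProductSpace ℝ E]
    {a b c : E} {t d : ℝ} (ht : t ∈ Set.Icc (0 : ℝ) 1) (ha : ‖a - c‖ = t * d)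
    (hb : ‖b - c‖ = (1 - t) * d) (hd : 0 ≤ d) (hab : d ≤ ‖a - b‖) :
    c = (1 - t) • a + t • b := by
  -- With the prescribed lengths the right side becomes t(1 - t)(d² - ‖a - b‖²), which is at most
  -- zero.
  have h := norm_sq_convex_combination (a - c) (b - c) t
  have e : (1 - t) • (a - c) + t • (b - c) = (1 - t) • a + t • b - c := by module
  rw [e, ha, hb, sub_sub_sub_cancel_right] at h
  have hsq : d ^ 2 ≤ ‖a - b‖ ^ 2 := by gcongr
  have h' : ‖(1 - t) • a + t • b - c‖ ^ 2 ≤ 0 := by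
    have := mul_le_mul_of_nonneg_left hsq (mul_nonneg ht.1 (sub_nonneg.2 ht.2))
    linarith
  have h0 : ‖(1 - t) • a + t • b - c‖ = 0 :=
    pow_eq_zero_iff two_ne_zero |>.1 (le_antisymm h' (sq_nonneg _))
  exact (sub_eq_zero.1 (norm_eq_zero.1 h0)).symm

theorem hasCurvatureBoundedBelowByZero (k : ℕ) :
    HasCurvatureBoundedBelowByZero (NetworkClass.{u} k) := by
  intro γ hγ x t
  have d0 := hγ.2.2 0 t t.2.1
  have d1 := hγ.2.2 t 1 t.2.2
  obtain ⟨P, hP⟩ := exists_rep (γ 0)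
  obtain ⟨Q, hQ⟩ := exists_rep (γ 1)
  obtain ⟨T, hT⟩ := exists_rep (γ t)
  obtain ⟨R, rfl⟩ := exists_rep x
  rw [← hP, ← hQ, ← hT] at d0 d1
  rw [← hP, ← hQ, ← hT]
  simp only [dist_toClass, Set.Icc.coe_zero, Set.Icc.coe_one, sub_zero] at d0 d1 ⊢
  obtain ⟨C₀, p, p', hp⟩ := exists_realDist_eq P T
  obtain ⟨C₁, q', q, hq⟩ := exists_realDist_eq T Q
  obtain ⟨C₂, r', r, hr⟩ := exists_realDist_eq T R
  -- All three optimal couplings involve T, so they glue over T; the pairs (P, Q), (P, R) and (Q, R)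
  -- need not be optimally coupled on `E`.
  obtain ⟨D, a, b, hab⟩ := BlockSpace.exists_glue p' q'
  obtain ⟨E, m, c, hmc⟩ := BlockSpace.exists_glue (p'.comp a) r'
  have hmc' := hmc T.kernel
  rw [BlockSpace.Hom.pull_comp] at hmc'
  have l0 := realDist_le ((p.comp a).comp m) (r.comp c)
  have l1 := realDist_le ((q.comp b).comp m) (r.comp c)
  have l2 := realDist_le ((p.comp a).comp m) ((q.comp b).comp m)
  simp only [BlockSpace.Hom.pull_comp] at l0 l1 l2
  rw [hp, ← a.pull.norm_map, ← m.pull.norm_map, map_sub, map_sub] at d0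
  rw [hq, norm_sub_rev, ← b.pull.norm_map, ← m.pull.norm_map, map_sub, map_sub, ← hab] at d1
  rw [hr, ← c.pull.norm_map, map_sub, ← hmc']
  set A := m.pull (a.pull (p.pull P.kernel))
  set B := m.pull (b.pull (q.pull Q.kernel))
  set Z := m.pull (a.pull (p'.pull T.kernel))
  set W := c.pull (r.pull R.kernel)
  set d := realDist P Q with hd
  have hd0 : 0 ≤ d := realDist_nonneg P Q
  -- The factor 2 undoes the 1/2 in the distance. The lower bound `2 * d ≤ ‖A - B‖` comes from `l2`.
  have hZ : Z = (1 - (t : ℝ)) • A + (t : ℝ) • B :=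
    eq_convex_combination (d := 2 * d) t.2 (by linarith) (by linarith) (by linarith)
      (by linarith)
  have e : Z - W = (1 - (t : ℝ)) • (A - W) + (t : ℝ) • (B - W) := by rw [hZ]; module
  have hAB : ‖A - B‖ ≤ 2 * d := by
    have := norm_sub_le_norm_sub_add_norm_sub A Z B
    rw [norm_sub_rev Z B] at this
    linarith
  rw [e, mul_pow, norm_sq_convex_combination, sub_sub_sub_cancel_right]
  have s0 : realDist P R ^ 2 ≤ (1 / 2 * ‖A - W‖) ^ 2 := by
    gcongr
    exact realDist_nonneg _ _
  have s1 : realDist Q R ^ 2 ≤ (1 / 2 * ‖B - W‖) ^ 2 := by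
    gcongr
    exact realDist_nonneg _ _
  have s2 : ‖A - B‖ ^ 2 ≤ (2 * d) ^ 2 := by gcongr
  have t0 : 0 ≤ (t : ℝ) := t.2.1
  have t1 : 0 ≤ 1 - (t : ℝ) := sub_nonneg.2 t.2.2
  have m0 := mul_le_mul_of_nonneg_left s0 t1
  have m1 := mul_le_mul_of_nonneg_left s1 t0
  have m2 := mul_le_mul_of_nonneg_left s2 (mul_nonneg t0 t1)
  linarith

end NetworkClass

/-! ### Gluing sequences of couplings -/

theorem trajMeasure_map_eval_zero {X : ℕ → Type u} [∀ n, MeasurableSpace (X n)]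
    (μ₀ : Measure (X 0)) [IsProbabilityMeasure μ₀]
    (κ : (n : ℕ) → Kernel ((i : Finset.Iic n) → X i) (X (n + 1))) [∀ n, IsMarkovKernel (κ n)] :
    (Kernel.trajMeasure μ₀ κ).map (fun x => x 0) = μ₀ := by
  have e : (fun x : (n : ℕ) → X n => x 0) =
      (fun y : (i : Finset.Iic 0) → X i => y ⟨0, by simp⟩) ∘ Preorder.frestrictLe 0 := rfl
  rw [e, ← Measure.map_map (by fun_prop) (by fun_prop), Kernel.trajMeasure,
    Measure.map_comp _ _ (by fun_prop), Kernel.traj_map_frestrictLe, Kernel.partialTraj_self,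
    Measure.id_comp]
  exact (Measure.map_map (measurable_pi_apply _) (MeasurableEquiv.measurable _)).trans
    Measure.map_id

/-- A sequence of couplings of consecutive probability measures is realised by a probability
measure on the product of all the spaces. -/
theorem exists_gluing_seq {X : ℕ → Type u} [∀ n, MeasurableSpace (X n)]
    [∀ n, StandardBorelSpace (X n)] (μ : ∀ n, Measure (X n)) [∀ n, IsProbabilityMeasure (μ n)]
    (π : ∀ n, Measure (X n × X (n + 1))) (h₁ : ∀ n, (π n).map Prod.fst = μ n)
    (h₂ : ∀ n, (π n).map Prod.snd = μ (n + 1)) :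
    ∃ ρ : Measure (∀ n, X n), IsProbabilityMeasure ρ ∧ (∀ n, ρ.map (fun x => x n) = μ n) ∧
      ∀ n, ρ.map (fun x => (x n, x (n + 1))) = π n := by
  have : ∀ n, Nonempty (X n) := fun n => (μ n).nonempty_of_neZero
  have hπ : ∀ n, IsProbabilityMeasure (π n) := fun n => by
    have : IsProbabilityMeasure ((π n).map Prod.fst) := (h₁ n).symm ▸ inferInstance
    exact Measure.isProbabilityMeasure_of_map Prod.fst
  -- A Markov chain: the transition sees only the last coordinate, through the disintegration of `π
  -- n`.
  let κ : (n : ℕ) → Kernel ((i : Finset.Iic n) → X i) (X (n + 1)) := fun n =>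
    (π n).condKernel.comap (fun x => x ⟨n, by simp⟩) (by fun_prop)
  have hκ : ∀ n, IsMarkovKernel (κ n) := fun n => by infer_instance
  let ρ := Kernel.trajMeasure (μ 0) κ
  -- The law at time `n` determines that of the pair at times `n` and `n + 1`, whose second marginal
  -- is the law at time `n + 1`; `main` inducts on this.
  have step : ∀ n, ρ.map (fun x => x n) = μ n → ρ.map (fun x => (x n, x (n + 1))) = π n := by
    intro n hn
    have h := Kernel.map_frestrictLe_trajMeasure_compProd_eq_map_trajMeasure (μ₀ := μ 0) (κ := κ)
      (a := n)
    have hm : Measurable fun z : ((i : Finset.Iic n) → X i) × X (n + 1) =>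
      (z.1 ⟨n, by simp⟩, z.2) := by fun_prop
    have h' := congrArg (Measure.map fun z : ((i : Finset.Iic n) → X i) × X (n + 1) =>
      (z.1 ⟨n, by simp⟩, z.2)) h
    rw [Measure.map_map hm (by fun_prop)] at h'
    refine Eq.trans ?_ (Eq.trans h'.symm ?_)
    · rfl
    · have hd := (π n).disintegrate (π n).condKernel
      rw [Measure.fst, h₁ n, ← hn] at hd
      refine Eq.trans ?_ hd
      ext s hs
      rw [Measure.map_apply hm hs, Measure.compProd_apply (hm hs), Measure.compProd_apply hs,
        lintegral_map (Kernel.measurable_kernel_prodMk_left (hm hs)) (by fun_prop),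
        lintegral_map (Kernel.measurable_kernel_prodMk_left hs) (by fun_prop)]
      rfl
  have main : ∀ n, ρ.map (fun x => x n) = μ n := by
    intro n
    induction n with
    | zero => exact trajMeasure_map_eval_zero (μ 0) κ
    | succ n ih =>
      have h := congrArg (Measure.map Prod.snd) (step n ih)
      rw [Measure.map_map measurable_snd (by fun_prop), h₂ n] at h
      exact h
  exact ⟨ρ, inferInstance, main, fun n => step n (main n)⟩

/-- Only consecutive distances are preserved, which suffices for a Cauchy estimate. -/
theorem BlockSpace.exists_glue_seq {k : ℕ} {A C : ℕ → BlockSpace.{u} k}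
    (f : ∀ n, (C n).Hom (A n)) (g : ∀ n, (C n).Hom (A (n + 1))) :
    ∃ (D : BlockSpace.{u} k) (h : ∀ n, D.Hom (A n)), ∀ n (K : (A n).L2) (L : (A (n + 1)).L2),
      ‖(h n).pull K - (h (n + 1)).pull L‖ = ‖(f n).pull K - (g n).pull L‖ := by
  choose ρ hρ hμ hπ using fun i => exists_gluing_seq (fun n => (A n).μ i)
    (fun n => jointLaw (f n) (g n) i) (fun n => map_fst_jointLaw (f n) (g n) i)
    (fun n => map_snd_jointLaw (f n) (g n) i)
  let D : BlockSpace.{u} k := { X := fun i => ∀ n, (A n).X i, μ := ρ }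
  let h : ∀ n, D.Hom (A n) := fun n =>
    ⟨fun i x => x n, fun i => ⟨measurable_pi_apply n, hμ i n⟩⟩
  refine ⟨D, h, fun n K L => ?_⟩
  rw [Hom.norm_pull_sub_pull (h n) (h (n + 1)) (jointLaw (f n) (g n)) (fun i => hπ i n)
      (map_fst_jointLaw (f n) (g n)) (map_snd_jointLaw (f n) (g n)),
    Hom.norm_pull_sub_pull (f n) (g n) (jointLaw (f n) (g n)) (fun i => rfl)
      (map_fst_jointLaw (f n) (g n)) (map_snd_jointLaw (f n) (g n))]

namespace NetworkClass

attribute [local instance] metricSpace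

/-! ### Completeness -/

theorem completeSpace (k : ℕ) : CompleteSpace (NetworkClass.{u} k) := by
  refine Metric.complete_of_convergent_controlled_sequences (fun n => (1 / 2 : ℝ) ^ n)
    (fun n => by positivity) fun x hx => ?_
  choose P hP using fun n => exists_rep (x n)
  choose C f g hfg using fun n => exists_realDist_eq (P n) (P (n + 1))
  obtain ⟨D, h, hh⟩ := BlockSpace.exists_glue_seq f g
  set K : ℕ → D.L2 := fun n => (h n).pull (P n).kernel with hKdef
  have hK : ∀ n, 0 ≤ K n := fun n => (h n).pull_nonneg (P n).kernel_nonneg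
  -- Consecutive classes are closer than (1/2)^n; the constant 2 again undoes the 1/2 in the
  -- distance.
  have hdist : ∀ n, dist (K n) (K (n + 1)) ≤ 2 * (1 / 2 : ℝ) ^ n := fun n => by
    have h1 := hx n n (n + 1) le_rfl (Nat.le_succ n)
    rw [← hP, ← hP, dist_toClass, hfg, ← hh] at h1
    rw [dist_eq_norm]
    linarith
  have hc : CauchySeq K := cauchySeq_of_le_geometric (1 / 2) 2 (by norm_num) hdist
  obtain ⟨L, hL⟩ := cauchySeq_tendsto_of_complete hc
  -- The nonnegative cone is closed, so the limit is again a network kernel.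
  have hL0 : 0 ≤ L := ge_of_tendsto' hL hK
  refine ⟨(ofKernel D L).toClass, tendsto_iff_dist_tendsto_zero.2 ?_⟩
  refine squeeze_zero (fun _ => dist_nonneg) (g := fun n => 1 / 2 * ‖K n - L‖) (fun n => ?_) ?_
  · rw [← hP, ← toClass_ofKernel_pull (h n)]
    exact dist_ofKernel_le (hK n) hL0
  · simpa only [mul_zero] using (tendsto_iff_norm_sub_tendsto_zero.1 hL).const_mul (1 / 2)

end NetworkClass

/-- The partitioned network `2`-distance descends to a (finite) metric on weak isomorphism classes,
and that metric makes them an Alexandrov space of non-negative curvature. -/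
theorem theorem2 (k : ℕ) (hk : 1 ≤ k) :
    ∃ m : MetricSpace (NetworkClass.{u} k),
      (∀ P Q : PartitionedMeasureNetwork.{u} k,
        edist P.toClass Q.toClass = PartitionedMeasureNetwork.networkDist P Q) ∧
      IsAlexandrovSpaceNonneg (NetworkClass.{u} k) :=
  letI := NetworkClass.metricSpace.{u} k
  ⟨this, NetworkClass.edist_toClass,
    { complete := NetworkClass.completeSpace k
      geodesic := NetworkClass.isGeodesicSpace k
      curvature := NetworkClass.hasCurvatureBoundedBelowByZero k }⟩
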